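/- An ideal on a set $X$ is a family $\mathcal I\subseteq\mathcal P(X)$ with $\emptyset\in\mathcal I$, $X\notin\mathcal I$, closed under subsets and finite unions; $\mathcal I^{+}=\mathcal P(X)\setminus\mathcal I$, and $\mathsf{cof}(\mathcal I)$ is the least size of a cofinal family in $(\mathcal I,\subseteq)$. Let $\mathfrak d$ be the least size of a family $D\subseteq\omega^\omega$ such that every $f\in\omega^\omega$ satisfies $f\le^* g$ (that is, $f(n)\le g(n)$ for all but finitely many $n$) for some $g\in D$, and let $\mathsf{cov}(\mathcal M)$ be the least size of a family of meager subsets of $\omega^\omega$ that covers $\omega^\omega$. Let $\mathcal{ED}$ be the ideal on $\omega\times\omega$ generated by the columns $\{n\}\times\omega$ ($n\in\omega$) and the graphs of functions from $\omega$ to $\omega$, and let $\mathcal{ED}_{\mathsf{fin}}$ be its restriction to $\triangle=\{(n,m): m\le n\}$, that is, $\mathcal{ED}_{\mathsf{fin}}=\mathcal{ED}\cap\mathcal P(\triangle)$. Let $\mathsf{non}^*(\mathcal{ED}_{\mathsf{fin}})$ be the least size of a family $\mathcal H$ of infinite subsets of $\triangle$ such that for every $A\in\mathcal{ED}_{\mathsf{fin}}$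 there is $H\in\mathcal H$ with $A\cap H$ finite. An ideal $\mathcal I$ on $\omega$ is $\mathsf Q^{+}$ if for every $X\in\mathcal I^{+}$ and every partition $\{P_n : n\in\omega\}$ of $X$ into finite sets there is $A\subseteq X$ with $A\in\mathcal I^{+}$ and $|A\cap P_n|\le 1$ for every $n$; let $\mathsf{non}(\mathsf Q^{+})$ be the least cofinality of an ideal on $\omega$ that is not $\mathsf Q^{+}$. Then $$\mathsf{cov}(\mathcal M)=\min\{\mathfrak d,\ \mathsf{non}^*(\mathcal{ED}_{\mathsf{fin}})\}=\min\{\mathfrak d,\ \mathsf{non}(\mathsf Q^{+})\}.$$ -/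

import Mathlib

open Cardinal Filter

/-! Ideals on a set `α` are the proper order ideals of the lattice `Set α`: `I : Order.Ideal (Set α)`
with `I.IsProper`. The cofinality of `(I, ⊆)` is `Order.cof I`. -/

namespace IdealInv

variable {α : Type*}

/-- The ideal generated by a family `G` of sets: the sets covered by finitely many members of `G`. -/
def generate (G : Set (Set α)) : Order.Ideal (Set α) where
  carrier := {A | ∃ S : Set (Set α), S ⊆ G ∧ S.Finite ∧ A ⊆ ⋃₀ S}
  lower' := fun _ _ hBA ⟨S, hS, hf, hA⟩ => ⟨S, hS, hf, hBA.trans hA⟩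
  nonempty' := ⟨∅, ∅, Set.empty_subset _, Set.finite_empty, Set.empty_subset _⟩
  directed' := by
    rintro A ⟨S, hS, hf, hA⟩ B ⟨T, hT, hg, hB⟩
    refine ⟨A ∪ B, ⟨S ∪ T, Set.union_subset hS hT, hf.union hg, ?_⟩,
      Set.subset_union_left, Set.subset_union_right⟩
    rw [Set.sUnion_union]
    exact Set.union_subset_union hA hB

/-- `generate G` is the least order ideal of `Set α` that contains `G`. -/
theorem generate_le_iff (G : Set (Set α)) (J : Order.Ideal (Set α)) :
    generate G ≤ J ↔ ∀ A ∈ G, A ∈ J := by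
  constructor
  · intro h A hA
    exact h ⟨{A}, by simpa using hA, Set.finite_singleton A, by simp⟩
  · rintro h A ⟨S, hS, hf, hA⟩
    refine J.lower hA ?_
    clear hA
    induction S, hf using Set.Finite.induction_on with
    | empty => simpa using J.bot_mem
    | @insert B S _ _ ih =>
      rw [Set.sUnion_insert]
      exact Order.Ideal.sup_mem (h B (hS (Set.mem_insert _ _)))
        (ih ((Set.subset_insert _ _).trans hS))

/-- The restriction of `I` to `X`, namely the members of `I` included in `X`,
seen as sets of points of the subtype `X`. -/
def restrict (I : Order.Ideal (Set α)) (X : Set α) : Order.Ideal (Set X) where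
  carrier := {A | Subtype.val '' A ∈ I}
  lower' := fun _ _ hBA hA => I.lower (Set.image_mono hBA) hA
  nonempty' := ⟨∅, by
    change Subtype.val '' (∅ : Set X) ∈ I
    rw [Set.image_empty]
    exact I.bot_mem⟩
  directed' := by
    intro A hA B hB
    refine ⟨A ∪ B, ?_, Set.subset_union_left, Set.subset_union_right⟩
    change Subtype.val '' (A ∪ B) ∈ I
    rw [Set.image_union]
    exact Order.Ideal.sup_mem hA hB

/-- The eventually different ideal: generated by the columns `{n} × ω` and the graphs of functions. -/
def ED : Order.Ideal (Set (ℕ × ℕ)) :=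
  generate ({C | ∃ n : ℕ, C = {p | p.1 = n}} ∪ {G | ∃ f : ℕ → ℕ, G = {p | p.2 = f p.1}})

/-- The triangle below the diagonal. -/
def triangle : Set (ℕ × ℕ) := {p | p.2 ≤ p.1}

/-- The restriction of the eventually different ideal to the triangle. -/
def EDfin : Order.Ideal (Set triangle) := restrict ED triangle

/-- `A` is a partial selector of `P`: it meets each piece in at most one point. -/
def IsPartialSelector (A : Set α) (P : ℕ → Set α) : Prop :=
  ∀ n, (A ∩ P n).Subsingleton

/-- `Q⁺`: every partition of a positive set into finite sets has a positive partial selector.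
(Pieces of the indexed partition may be empty.) -/
def IsQPlus (I : Order.Ideal (Set α)) : Prop :=
  ∀ X : Set α, X ∉ I → ∀ P : ℕ → Set α,
    (∀ n, (P n).Finite) → Pairwise (fun m n => Disjoint (P m) (P n)) → ⋃ n, P n = X →
      ∃ A : Set α, A ∉ I ∧ A ⊆ X ∧ IsPartialSelector A P

/-- The uniformity number of a class `Γ` of ideals on `ω`: the least cofinality of an ideal
on `ω` that is not in `Γ`. -/
noncomputable def nonClass (Γ : Order.Ideal (Set ℕ) → Prop) : Cardinal.{0} :=
  sInf {c | ∃ I : Order.Ideal (Set ℕ), I.IsProper ∧ ¬ Γ I ∧ c = Order.cof I}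

/-- `non*(I)`: the least size of a family `H` of infinite sets such that every member of `I` has
finite intersection with some member of `H`. -/
noncomputable def nonStar {α : Type} (I : Order.Ideal (Set α)) : Cardinal.{0} :=
  sInf {c | ∃ H : Set (Set α), (∀ B ∈ H, B.Infinite) ∧
    (∀ A ∈ I, ∃ B ∈ H, (A ∩ B).Finite) ∧ c = #H}

/-- The dominating number `𝔡`. -/
noncomputable def dominatingNumber : Cardinal.{0} :=
  sInf {c | ∃ D : Set (ℕ → ℕ), (∀ f : ℕ → ℕ, ∃ g ∈ D, ∀ᶠ n in cofinite, f n ≤ g n) ∧ c = #D}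

/-- `cov(𝓜)`: the least size of a family of meager sets that covers the Baire space `ω^ω`. -/
noncomputable def covMeager : Cardinal.{0} :=
  sInf {c | ∃ F : Set (Set (ℕ → ℕ)), (∀ M ∈ F, IsMeagre M) ∧ ⋃₀ F = Set.univ ∧ c = #F}

end IdealInv

namespace IdealInv

/-! ### Meager sets and the bounds on `cov(𝓜)` -/

theorem exists_forall_agree_mem_of_isOpen {U : Set (ℕ → ℕ)} (hU : IsOpen U) {x : ℕ → ℕ}
    (hx : x ∈ U) : ∃ m, ∀ y : ℕ → ℕ, (∀ i < m, y i = x i) → y ∈ U := by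
  obtain ⟨v, ⟨z, m, rfl⟩, hxv, hvU⟩ :=
    (PiNat.isTopologicalBasis_cylinders (fun _ : ℕ => ℕ)).exists_subset_of_mem_open hx hU
  refine ⟨m, fun y hy => hvU ?_⟩
  rw [PiNat.mem_cylinder_iff] at hxv ⊢
  exact fun i hi => (hy i hi).trans (hxv i hi)

/-- Any finite initial segment can be continued so as to enter `S n` at a later `n`, so entering
beyond `k` is an open dense condition. -/
theorem isMeagre_setOf_finite {S : ℕ → Set ℕ} (hS : {n | (S n).Nonempty}.Infinite) :
    IsMeagre {f : ℕ → ℕ | {n | f n ∈ S n}.Finite} := by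
  have key : ∀ k, {f : ℕ → ℕ | ∃ n, k ≤ n ∧ f n ∈ S n} ∈ residual (ℕ → ℕ) := by
    intro k
    apply residual_of_dense_open
    · have : {f : ℕ → ℕ | ∃ n, k ≤ n ∧ f n ∈ S n} =
          ⋃ n, ⋃ _ : k ≤ n, (fun f : ℕ → ℕ => f n) ⁻¹' S n := by
        ext f; simp
      rw [this]
      exact isOpen_iUnion fun n => isOpen_iUnion fun _ =>
        (isOpen_discrete (S n)).preimage (continuous_apply n)
    · rw [dense_iff_inter_open]
      rintro U hU ⟨f, hf⟩
      obtain ⟨m, hm⟩ := exists_forall_agree_mem_of_isOpen hU hf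
      obtain ⟨n, ⟨v, hv⟩, hn⟩ := hS.exists_gt (max m k)
      refine ⟨Function.update f n v, hm _ fun i hi => ?_, n, by omega, by simpa using hv⟩
      rw [Function.update_of_ne (by omega)]
  rw [IsMeagre]
  filter_upwards [countable_iInter_mem.2 key] with f hf hfin
  rw [Set.mem_iInter] at hf
  obtain ⟨N, hN⟩ := hfin.bddAbove
  obtain ⟨n, hn, hfn⟩ := hf (N + 1)
  have : n ≤ N := hN hfn
  omega

theorem covMeager_le {F : Set (Set (ℕ → ℕ))} (hF : ∀ M ∈ F, IsMeagre M)
    (hcov : ∀ f, ∃ M ∈ F, f ∈ M) : covMeager ≤ #F :=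
  csInf_le' ⟨F, hF, Set.eq_univ_of_forall fun f => by simpa using hcov f, rfl⟩

theorem exists_covMeager :
    ∃ F : Set (Set (ℕ → ℕ)), (∀ M ∈ F, IsMeagre M) ∧ ⋃₀ F = Set.univ ∧ covMeager = #F := by
  refine csInf_mem (s := {c | ∃ F : Set (Set (ℕ → ℕ)), (∀ M ∈ F, IsMeagre M) ∧
    ⋃₀ F = Set.univ ∧ c = #F}) ⟨_, Set.range fun f => {f}, ?_, ?_, rfl⟩
  · rintro _ ⟨f, rfl⟩
    refine (isMeagre_setOf_finite (S := fun n => {v | v ≠ f n}) ?_).mono ?_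
    · have : {n | ({v | v ≠ f n} : Set ℕ).Nonempty} = Set.univ :=
        Set.eq_univ_of_forall fun n => ⟨f n + 1, by simp⟩
      rw [this]
      exact Set.infinite_univ
    · rintro _ rfl
      simp
  · exact Set.eq_univ_of_forall fun f => ⟨{f}, ⟨f, rfl⟩, rfl⟩

theorem aleph0_le_mk_of_sUnion_eq_univ {F : Set (Set (ℕ → ℕ))} (hF : ∀ M ∈ F, IsMeagre M)
    (hcov : ⋃₀ F = Set.univ) : ℵ₀ ≤ #F := by
  by_contra h
  have hc : F.Countable := by
    rw [← Cardinal.le_aleph0_iff_set_countable]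
    exact (not_le.1 h).le
  have : IsMeagre (⋃ M ∈ F, M) := isMeagre_biUnion hc hF
  rw [← Set.sUnion_eq_biUnion, hcov] at this
  simpa using (dense_of_mem_residual this).nonempty

theorem covMeager_le_dominatingNumber : covMeager ≤ dominatingNumber := by
  refine le_csInf ⟨_, Set.univ, fun f => ⟨f, trivial, by simp⟩, rfl⟩ ?_
  rintro _ ⟨D, hD, rfl⟩
  refine (covMeager_le (F := (fun g => {f : ℕ → ℕ | {n | f n ∈ Set.Ioi (g n)}.Finite}) '' D)
    ?_ ?_).trans Cardinal.mk_image_le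
  · rintro _ ⟨g, -, rfl⟩
    apply isMeagre_setOf_finite
    have : {n | (Set.Ioi (g n)).Nonempty} = Set.univ := by
      ext n; simp [Set.nonempty_Ioi]
    rw [this]
    exact Set.infinite_univ
  · intro f
    obtain ⟨g, hg, h⟩ := hD f
    refine ⟨_, ⟨g, hg, rfl⟩, ?_⟩
    rw [eventually_cofinite] at h
    simpa using h

theorem covMeager_le_mk_of_EDfin {H : Set (Set triangle)} (hinf : ∀ B ∈ H, B.Infinite)
    (hH : ∀ A ∈ EDfin, ∃ B ∈ H, (A ∩ B).Finite) : covMeager ≤ #H := by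
  -- Reduction mod `n + 1` folds any function below the diagonal and fixes the values `v ≤ n`, so
  -- every point of `B` can still be hit.
  let val : ℕ → ℕ → triangle := fun n v => ⟨(n, v % (n + 1)), Nat.lt_succ_iff.1 (Nat.mod_lt _ n.succ_pos)⟩
  refine (covMeager_le (F := (fun B => {f : ℕ → ℕ | {n | f n ∈ {v | val n v ∈ B}}.Finite}) '' H)
    ?_ ?_).trans Cardinal.mk_image_le
  · rintro _ ⟨B, hB, rfl⟩
    apply isMeagre_setOf_finite
    intro hfin
    refine hinf B hB ?_
    obtain ⟨N, hN⟩ := hfin.bddAbove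
    refine Set.Finite.of_finite_image (f := Subtype.val)
      (((Set.finite_Iic N).prod (Set.finite_Iic N)).subset ?_) Subtype.val_injective.injOn
    rintro _ ⟨⟨⟨n, v⟩, hv : v ≤ n⟩, hB, rfl⟩
    have hn : n ≤ N := hN ⟨v, by
      simpa [val, Nat.mod_eq_of_lt (Nat.lt_succ_of_le hv)] using hB⟩
    exact ⟨hn, hv.trans hn⟩
  · intro f
    obtain ⟨B, hB, hfin⟩ := hH (Set.range fun n => val n (f n)) (by
      refine ⟨{{p | p.2 = f p.1 % (p.1 + 1)}}, ?_, Set.finite_singleton _, ?_⟩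
      · rintro _ rfl
        exact Or.inr ⟨fun n => f n % (n + 1), rfl⟩
      · rintro _ ⟨_, ⟨n, rfl⟩, rfl⟩
        simp [val])
    refine ⟨_, ⟨B, hB, rfl⟩, ?_⟩
    refine Set.Finite.of_finite_image (f := fun n => val n (f n)) (hfin.subset ?_) ?_
    · rintro _ ⟨n, hn, rfl⟩
      exact ⟨⟨n, rfl⟩, hn⟩
    · intro m _ n _ h
      exact congrArg (fun t : triangle => t.1.1) h

/-! ### From a failure of `Q⁺` to a witness for `non*` -/

/-- The sets `G` in the plane whose trace, under the placement of `x ∈ P n` at `(c n, x)`,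
belongs to `I`. -/
def traceIdeal (I : Order.Ideal (Set ℕ)) (P : ℕ → Set ℕ) (c : ℕ → ℕ) :
    Order.Ideal (Set (ℕ × ℕ)) where
  carrier := {G | {x | ∃ n, x ∈ P n ∧ (c n, x) ∈ G} ∈ I}
  lower' := fun _ _ hBA hA => I.lower (by rintro x ⟨n, hx, h⟩; exact ⟨n, hx, hBA h⟩) hA
  nonempty' := ⟨∅, I.lower (by rintro x ⟨_, _, h⟩; exact h.elim) I.bot_mem⟩
  directed' := by
    intro A hA B hB
    refine ⟨A ∪ B, I.lower ?_ (Order.Ideal.sup_mem hA hB), Set.subset_union_left,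
      Set.subset_union_right⟩
    rintro x ⟨n, hx, h | h⟩
    exacts [Or.inl ⟨n, hx, h⟩, Or.inr ⟨n, hx, h⟩]

theorem finite_mem_of_singleton_mem {I : Order.Ideal (Set ℕ)} {X A : Set ℕ}
    (hX : ∀ x ∈ X, {x} ∈ I) (hA : A.Finite) (hAX : A ⊆ X) : A ∈ I := by
  induction A, hA using Set.Finite.induction_on with
  | empty => exact I.bot_mem
  | @insert a s _ _ ih =>
    rw [Set.insert_eq]
    exact Order.Ideal.sup_mem (hX a (hAX (Set.mem_insert _ _)))
      (ih ((Set.subset_insert _ _).trans hAX))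

theorem exists_strictMono_bound {P : ℕ → Set ℕ} (hP : ∀ n, (P n).Finite) :
    ∃ c : ℕ → ℕ, StrictMono c ∧ ∀ n, ∀ x ∈ P n, x ≤ c n := by
  choose b hb using fun n => (hP n).bddAbove
  refine ⟨fun n => n + ∑ j ∈ Finset.range (n + 1), b j, strictMono_nat_of_lt_succ fun n => ?_,
    fun n x hx => (hb n hx).trans ?_⟩
  · rw [Finset.sum_range_succ _ (n + 1)]
    omega
  · have := Finset.single_le_sum (f := b) (fun _ _ => Nat.zero_le _)
      (Finset.mem_range.2 (Nat.lt_add_one n))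
    dsimp only
    omega

/-- With `P n` placed in column `c n`, columns have finite trace and graphs trace partial selectors
of `P`, so every set in `ED` has its trace in `I`. The complement of a `J ∈ I` containing that trace
misses the set, and it is infinite because `X ∉ I`. -/
theorem exists_nonStar_witness {I : Order.Ideal (Set ℕ)} (hI : ¬ IsQPlus I) :
    ∃ H : Set (Set triangle), (∀ B ∈ H, B.Infinite) ∧
      (∀ A ∈ EDfin, ∃ B ∈ H, (A ∩ B).Finite) ∧ #H ≤ Order.cof I := by
  unfold IsQPlus at hI
  push Not at hI
  obtain ⟨X, hX, P, hfin, hdisj, hun, hsel⟩ := hI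
  have hsel' : ∀ A ⊆ X, IsPartialSelector A P → A ∈ I := fun A h1 h2 => by
    by_contra h
    exact hsel A h h1 h2
  have hsing : ∀ x ∈ X, {x} ∈ I := fun x hx =>
    hsel' _ (by simpa using hx) fun n => Set.subsingleton_singleton.anti Set.inter_subset_left
  have hPX : ∀ n, P n ⊆ X := fun n => hun ▸ Set.subset_iUnion P n
  obtain ⟨c, hc, hcP⟩ := exists_strictMono_bound hfin
  obtain ⟨C, hC, hcard⟩ := Order.exists_cof_eq I
  let B : I → Set triangle := fun J => {t | ∃ n, t.1.1 = c n ∧ t.1.2 ∈ P n \ J.1}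
  refine ⟨B '' C, ?_, ?_, Cardinal.mk_image_le.trans hcard.le⟩
  · rintro _ ⟨J, -, rfl⟩ hB
    have hXJ : (X \ J.1).Finite := by
      refine (hB.image fun t => t.1.2).subset ?_
      rintro x ⟨hx, hxJ⟩
      obtain ⟨n, hn⟩ := Set.mem_iUnion.1 (hun ▸ hx)
      exact ⟨⟨(c n, x), hcP n x hn⟩, ⟨n, rfl, hn, hxJ⟩, rfl⟩
    have := Order.Ideal.sup_mem (finite_mem_of_singleton_mem hsing hXJ Set.sdiff_subset) J.2
    exact hX (I.lower (by intro x hx; by_cases h : x ∈ J.1; exacts [Or.inr h, Or.inl ⟨hx, h⟩]) this)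
  · intro A hA
    have hle : ED ≤ traceIdeal I P c := by
      rw [ED, generate_le_iff]
      rintro _ (⟨k, rfl⟩ | ⟨f, rfl⟩)
      · refine finite_mem_of_singleton_mem hsing ?_ ?_
        · by_cases h : ∃ n, c n = k
          · obtain ⟨n, rfl⟩ := h
            refine (hfin n).subset ?_
            rintro x ⟨m, hx, h⟩
            rwa [← hc.injective h]
          · convert Set.finite_empty
            ext x
            simp only [Set.mem_ofPred_eq, Set.mem_empty_iff_false, iff_false]
            rintro ⟨n, -, h'⟩
            exact h ⟨n, h'⟩
        · rintro x ⟨n, hx, -⟩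
          exact hPX n hx
      · refine hsel' _ ?_ ?_
        · rintro x ⟨n, hx, -⟩
          exact hPX n hx
        · rintro n x ⟨⟨m, hxm, hx⟩, hxn⟩ y ⟨⟨l, hyl, hy⟩, hyn⟩
          have hm : m = n := by
            by_contra h
            exact Set.disjoint_left.1 (hdisj h) hxm hxn
          have hl : l = n := by
            by_contra h
            exact Set.disjoint_left.1 (hdisj h) hyl hyn
          subst hm hl
          exact Eq.trans hx (Eq.symm hy)
    have hA' : {x | ∃ n, x ∈ P n ∧ (c n, x) ∈ Subtype.val '' A} ∈ I := hle hA
    obtain ⟨J, hJ, hAJ⟩ := hC ⟨_, hA'⟩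
    refine ⟨_, ⟨J, hJ, rfl⟩, ?_⟩
    convert Set.finite_empty
    ext t
    simp only [Set.mem_inter_iff, Set.mem_empty_iff_false, iff_false]
    rintro ⟨htA, n, h1, h2, h3⟩
    exact h3 (hAJ ⟨n, h2, t, htA, Prod.ext h1 rfl⟩)

/-! ### Building ideals that are not `Q⁺` -/

/-- A directed family of sets that covers all selectors of a partition into finite sets,
but never everything, yields an ideal on `ℕ` that is not `Q⁺`. -/
theorem exists_not_isQPlus {Q ι : Type} [Countable Q] [SemilatticeSup ι] [Nonempty ι] (p : Q → ℕ)
    (hp : ∀ n, (p ⁻¹' {n}).Finite) (D : ι → Set Q) (hD : Monotone D)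
    (hne : ∀ i, D i ≠ Set.univ) (hsel : ∀ A : Set Q, A.InjOn p → ∃ i, A ⊆ D i) :
    ∃ I : Order.Ideal (Set ℕ), I.IsProper ∧ ¬ IsQPlus I ∧ Order.cof I ≤ #ι := by
  obtain ⟨e, he⟩ := exists_injective_nat Q
  -- Numbers outside the range of `e` lie in every `E i`, so only the copy of `Q` matters.
  let E : ι → Set ℕ := fun i => {q | ∀ z, e z = q → z ∈ D i}
  have hE : Monotone E := fun i j hij q hq z hz => hD hij (hq z hz)
  let I : Order.Ideal (Set ℕ) :=
    { carrier := {A | ∃ i, A ⊆ E i}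
      lower' := fun _ _ hBA ⟨i, hi⟩ => ⟨i, hBA.trans hi⟩
      nonempty' := ⟨∅, Classical.arbitrary ι, Set.empty_subset _⟩
      directed' := by
        rintro A ⟨i, hi⟩ B ⟨j, hj⟩
        exact ⟨A ∪ B, ⟨i ⊔ j, Set.union_subset (hi.trans (hE le_sup_left))
          (hj.trans (hE le_sup_right))⟩, Set.subset_union_left, Set.subset_union_right⟩ }
  have hX : Set.range e ∉ I := by
    rintro ⟨i, hi⟩
    exact hne i (Set.eq_univ_of_forall fun z => hi ⟨z, rfl⟩ z rfl)
  refine ⟨I, Order.Ideal.isProper_of_notMem hX, fun hQ => ?_, ?_⟩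
  · obtain ⟨A, hA, hAX, hAP⟩ := hQ _ hX (fun n => e '' (p ⁻¹' {n})) (fun n => (hp n).image e)
      (fun m n hmn => (Set.disjoint_image_iff he).2 (Disjoint.preimage p (by simpa using hmn)))
      (by ext q; simp)
    obtain ⟨i, hi⟩ := hsel (e ⁻¹' A) fun y hy z hz hyz =>
      he (hAP (p z) ⟨hy, y, hyz, rfl⟩ ⟨hz, z, rfl, rfl⟩)
    refine hA ⟨i, ?_⟩
    rintro q hq z rfl
    exact hi hq
  · have hcof : IsCofinal (Set.range fun i => (⟨E i, i, subset_rfl⟩ : I)) := by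
      rintro ⟨A, i, hi⟩
      exact ⟨_, ⟨i, rfl⟩, hi⟩
    exact (Order.cof_le hcof).trans Cardinal.mk_range_le

/-- Needed because the infimum of an empty set of cardinals is `0`: lower bounds on `nonStar` and
`nonClass` require nonempty families. -/
theorem exists_isProper_not_isQPlus :
    ∃ I : Order.Ideal (Set ℕ), I.IsProper ∧ ¬ IsQPlus I := by
  classical
  let Q := Σ n : ℕ, Fin (n + 1)
  obtain ⟨I, h1, h2, -⟩ := exists_not_isQPlus (Q := Q)
    (ι := Finset (ℕ → ℕ)) Sigma.fst
    (fun n => (Set.finite_range (Sigma.mk n : _ → Q)).subset (by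
      rintro ⟨_, w⟩ rfl
      exact ⟨w, rfl⟩))
    (fun s => {z | ∃ f ∈ s, f z.1 = z.2})
    (by
      rintro s t hst z ⟨f, hf, h⟩
      exact ⟨f, hst hf, h⟩)
    (by
      intro s hs
      -- Column `s.card` has `s.card + 1` points, too many for `s.card` graphs.
      have : Finset.range (s.card + 1) ⊆ s.image fun f => f s.card := by
        intro v hv
        have : (⟨s.card, ⟨v, Finset.mem_range.1 hv⟩⟩ : Q) ∈
          {z : Q | ∃ f ∈ s, f z.1 = z.2} := hs ▸ trivial
        obtain ⟨f, hf, h⟩ := this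
        exact Finset.mem_image.2 ⟨f, hf, h⟩
      have := (Finset.card_le_card this).trans Finset.card_image_le
      simp at this)
    (by
      intro A hA
      let g : ℕ → ℕ := fun n => if h : ∃ w, (⟨n, w⟩ : Q) ∈ A then h.choose else 0
      refine ⟨{g}, ?_⟩
      rintro ⟨n, w⟩ hz
      have h : ∃ w, (⟨n, w⟩ : Q) ∈ A := ⟨w, hz⟩
      refine ⟨_, Finset.mem_singleton_self _, ?_⟩
      have := hA h.choose_spec hz rfl
      have hw : h.choose = w := eq_of_heq (Sigma.mk.inj this).2
      simp only [g, dif_pos h, hw])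
  exact ⟨I, h1, h2⟩

theorem covMeager_le_nonStar : covMeager ≤ nonStar EDfin := by
  obtain ⟨I, -, hI⟩ := exists_isProper_not_isQPlus
  obtain ⟨H, h1, h2, -⟩ := exists_nonStar_witness hI
  refine le_csInf ⟨_, H, h1, h2, rfl⟩ ?_
  rintro _ ⟨H, h1, h2, rfl⟩
  exact covMeager_le_mk_of_EDfin h1 h2

theorem nonStar_le_nonClass : nonStar EDfin ≤ nonClass IsQPlus := by
  obtain ⟨I, hp, hI⟩ := exists_isProper_not_isQPlus
  refine le_csInf ⟨_, I, hp, hI, rfl⟩ ?_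
  rintro _ ⟨I, -, hI, rfl⟩
  obtain ⟨H, h1, h2, h3⟩ := exists_nonStar_witness hI
  exact (csInf_le' ⟨H, h1, h2, rfl⟩ : nonStar EDfin ≤ #H).trans h3

/-! ### Words forcing membership in dense open sets, and interval partitions -/

/-- The pairs of stem and dense open set are treated one at a time, each lengthening the common
block; what an earlier part has forced survives. -/
theorem exists_block_forall_mem {n : ℕ} {T : Set ((ℕ → ℕ) × Set (ℕ → ℕ))} (hT : T.Finite)
    (hTU : ∀ t ∈ T, IsOpen t.2 ∧ Dense t.2) :
    ∃ (b : ℕ) (y : ℕ → ℕ), ∀ t ∈ T, ∀ x : ℕ → ℕ, (∀ i < n, x i = t.1 i) →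
      (∀ i, n ≤ i → i < b → x i = y i) → x ∈ t.2 := by
  induction T, hT using Set.Finite.induction_on with
  | empty => exact ⟨0, 0, by simp⟩
  | @insert t T _ _ ih =>
    obtain ⟨b, y, hy⟩ := ih fun t ht => hTU t (Set.mem_insert_of_mem _ ht)
    obtain ⟨hopen, hdense⟩ := hTU t (Set.mem_insert _ _)
    let z : ℕ → ℕ := fun i => if i < n then t.1 i else y i
    obtain ⟨u, huz, hu⟩ := dense_iff_inter_open.1 hdense _
      (PiNat.isOpen_cylinder (fun _ => ℕ) z (max n b)) ⟨z, PiNat.self_mem_cylinder z _⟩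
    rw [PiNat.mem_cylinder_iff] at huz
    obtain ⟨m, hm⟩ := exists_forall_agree_mem_of_isOpen hopen hu
    refine ⟨max b m, u, fun t' ht' x hx hxu => ?_⟩
    obtain rfl | ht' := Set.mem_insert_iff.1 ht'
    · refine hm x fun i hi => ?_
      by_cases hin : i < n
      · rw [hx i hin, huz i (by omega)]
        simp [z, hin]
      · exact hxu i (by omega) (by omega)
    · refine hy t' ht' x hx fun i hi hib => ?_
      rw [hxu i hi (by omega), huz i (by omega)]
      simp [z, not_lt.2 hi]

theorem exists_bounded_block_forall_mem (n : ℕ) {𝒰 : Set (Set (ℕ → ℕ))} (hfin : 𝒰.Finite)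
    (h𝒰 : ∀ U ∈ 𝒰, IsOpen U ∧ Dense U) :
    ∃ (b : ℕ) (y : ℕ → ℕ), (∀ i, y i < b) ∧ ∀ U ∈ 𝒰, ∀ x : ℕ → ℕ, (∀ i < n, x i < n) →
      (∀ i, n ≤ i → i < b → x i = y i) → x ∈ U := by
  let S : Set (ℕ → ℕ) :=
    Set.range fun (s : Fin n → Fin n) i => if h : i < n then (s ⟨i, h⟩ : ℕ) else 0
  obtain ⟨b, y, hy⟩ := exists_block_forall_mem (n := n) ((Set.finite_range _ : S.Finite).prod hfin)
    fun t ht => h𝒰 _ ht.2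
  -- One number bounds both the length of the block and its values; `y` is cut to `0` beyond the old
  -- `b`.
  refine ⟨b + ∑ i ∈ Finset.range b, y i + 1, fun i => if i < b then y i else 0, fun i => ?_,
    fun U hU x hx hxy => ?_⟩
  · dsimp only
    split_ifs with h
    · have := Finset.single_le_sum (f := y) (fun _ _ => Nat.zero_le _) (Finset.mem_range.2 h)
      omega
    · omega
  · refine hy (fun i => if h : i < n then x i else 0, U)
      ⟨⟨fun i => ⟨x i, hx i i.2⟩, rfl⟩, hU⟩ x (fun i hi => by simp [hi]) fun i hi hib => ?_
    exact (hxy i hi (by omega)).trans (if_pos hib)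

theorem exists_not_dominated {ι : Type} (φ : ι → ℕ → ℕ) (hι : #ι < dominatingNumber) :
    ∃ g : ℕ → ℕ, ∀ i, {n | φ i n < g n}.Infinite := by
  by_contra! h
  refine (hι.trans_le ?_).false
  refine (csInf_le' ⟨Set.range φ, fun f => ?_, rfl⟩ : dominatingNumber ≤ _).trans
    Cardinal.mk_range_le
  obtain ⟨i, hi⟩ := h f
  refine ⟨φ i, ⟨i, rfl⟩, ?_⟩
  rw [eventually_cofinite]
  simpa using hi

theorem exists_monotone_bound (φ : ℕ → ℕ) :
    ∃ ψ : ℕ → ℕ, Monotone ψ ∧ ∀ n, n < ψ n ∧ φ n ≤ ψ n := by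
  refine ⟨fun n => n + 1 + ∑ j ∈ Finset.range (n + 1), φ j, monotone_nat_of_le_succ fun n => ?_,
    fun n => ?_⟩
  · rw [Finset.sum_range_succ _ (n + 1)]
    omega
  · have := Finset.single_le_sum (f := φ) (fun _ _ => Nat.zero_le _)
      (Finset.mem_range.2 (Nat.lt_add_one n))
    dsimp only
    omega

/-- Take `g` not dominated by any `ψ i ∘ ψ i` and iterate a monotone majorant of `g`. If `ψ i (ψ i
k) < g k` with `k` in block `n`, then `ψ i (ψ i (a n)) < a (n + 2)`, so block `n` or block `n + 1`
is long enough. -/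
theorem exists_interval_partition {ι : Type} (φ : ι → ℕ → ℕ) (hι : #ι < dominatingNumber) :
    ∃ a : ℕ → ℕ, StrictMono a ∧ a 0 = 0 ∧ ∀ i m, ∃ n, m ≤ n ∧ φ i (a n) ≤ a (n + 1) := by
  choose ψ hmono hψ using fun i => exists_monotone_bound (φ i)
  obtain ⟨g, hg⟩ := exists_not_dominated (fun i n => ψ i (ψ i n)) hι
  obtain ⟨G, hGmono, hG⟩ := exists_monotone_bound g
  let a : ℕ → ℕ := fun n => G^[n] 0
  have hsucc : ∀ n, a (n + 1) = G (a n) := fun n => Function.iterate_succ_apply' G n 0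
  have ha : StrictMono a := strictMono_nat_of_lt_succ fun n => by
    rw [hsucc]
    exact (hG _).1
  refine ⟨a, ha, rfl, fun i m => ?_⟩
  obtain ⟨k, hk, hmk⟩ := (hg i).exists_gt (a m)
  have hex : ∃ n, k < a (n + 1) := ⟨k, k.lt_succ_self.trans_le (ha.le_apply)⟩
  classical
  let n := Nat.find hex
  have hn : k < a (n + 1) := Nat.find_spec hex
  have hn' : a n ≤ k := by
    rcases h : n with _ | l
    · exact Nat.zero_le _
    · have := Nat.find_min hex (m := l) (by omega)
      omega
  have hmn : m ≤ n := by
    by_contra h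
    have := ha.monotone (show n + 1 ≤ m by omega)
    omega
  have hlt : ψ i (ψ i (a n)) < a (n + 2) := by
    calc ψ i (ψ i (a n)) ≤ ψ i (ψ i k) := hmono i (hmono i hn')
      _ < g k := hk
      _ ≤ G k := (hG k).2
      _ ≤ G (a (n + 1)) := hGmono hn.le
      _ = a (n + 2) := (hsucc _).symm
  by_cases h : ψ i (a n) ≤ a (n + 1)
  · exact ⟨n, hmn, (hψ i _).2.trans h⟩
  · refine ⟨n + 1, by omega, (hψ i _).2.trans ((hmono i ?_).trans hlt.le)⟩
    omega

theorem exists_dense_open_seq_of_isMeagre {M : Set (ℕ → ℕ)} (hM : IsMeagre M) :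
    ∃ U : ℕ → Set (ℕ → ℕ), (∀ k, IsOpen (U k) ∧ Dense (U k)) ∧ ∀ x ∈ M, ∃ k, x ∉ U k := by
  obtain ⟨S, hSo, hSd, hSc, hS⟩ := mem_residual_iff.1 hM
  -- Adding `Set.univ` makes the countable family nonempty, hence enumerable by `ℕ`.
  obtain ⟨U, hU⟩ := (hSc.insert Set.univ).exists_eq_range (Set.insert_nonempty _ _)
  refine ⟨U, fun k => ?_, fun x hx => ?_⟩
  · obtain h | h := Set.mem_insert_iff.1 (hU ▸ Set.mem_range_self k : U k ∈ insert Set.univ S)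
    · rw [h]
      exact ⟨isOpen_univ, dense_univ⟩
    · exact ⟨hSo _ h, hSd _ h⟩
  · by_contra! h
    refine hS (Set.mem_sInter.2 fun V hV => ?_) hx
    obtain ⟨k, rfl⟩ := hU ▸ Set.mem_insert_of_mem Set.univ hV
    exact h k

/-! ### The ideal of words that fail to avoid meager sets -/

theorem nonClass_isQPlus_le_covMeager (h : covMeager < dominatingNumber) :
    nonClass IsQPlus ≤ covMeager := by
  classical
  obtain ⟨F, hF, hcov, hcard⟩ := exists_covMeager
  have hinf : ℵ₀ ≤ #F := aleph0_le_mk_of_sUnion_eq_univ hF hcov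
  have : Infinite F := Cardinal.infinite_iff.2 hinf
  have hFin : #(Finset F) = #F := Cardinal.mk_finset_of_infinite F
  choose U hU hUM using fun M : F => exists_dense_open_seq_of_isMeagre (hF M M.2)
  have hfin : ∀ (s : Finset F) (n : ℕ), {V | ∃ M ∈ s, ∃ k ≤ n, V = U M k}.Finite := by
    intro s n
    refine ((s ×ˢ Finset.range (n + 1)).finite_toSet.image fun q => U q.1 q.2).subset ?_
    rintro _ ⟨M, hM, k, hk, rfl⟩
    exact ⟨(M, k), by simp [hM, hk], rfl⟩
  choose b y hyb hb using fun (s : Finset F) (n : ℕ) =>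
    exists_bounded_block_forall_mem n (hfin s n) (by rintro _ ⟨M, -, k, -, rfl⟩; exact hU M k)
  obtain ⟨a, ha, ha0, hab⟩ := exists_interval_partition b (by rwa [hFin, ← hcard])
  let Q := Σ n : ℕ, Fin (a (n + 1)) → Fin (a (n + 1))
  -- A word is bad for `(s, m)` if its block precedes `m`, or if some real extending it, with a stem
  -- bounded by `a n`, escapes one of the first `n + 1` dense open sets of a member of `s`.
  let D : Finset F × ℕ → Set Q := fun t => {z | z.1 < t.2 ∨ ∃ x : ℕ → ℕ,
    (∀ i < a z.1, x i < a z.1) ∧ (∀ i : Fin (a (z.1 + 1)), a z.1 ≤ i → x i = z.2 i) ∧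
      ∃ M ∈ t.1, ∃ k ≤ z.1, x ∉ U M k}
  obtain ⟨I, hIp, hIQ, hIcof⟩ := exists_not_isQPlus (Q := Q) Sigma.fst
    (fun n => (Set.finite_range (Sigma.mk n : _ → Q)).subset (by
      rintro ⟨_, w⟩ rfl
      exact ⟨w, rfl⟩)) D
    (by
      rintro ⟨s, m⟩ ⟨t, l⟩ ⟨hst, hml⟩ z (hz | ⟨x, h1, h2, M, hM, h3⟩)
      · exact Or.inl (hz.trans_le hml)
      · exact Or.inr ⟨x, h1, h2, M, hst hM, h3⟩)
    (by
      rintro ⟨s, m⟩ hD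
      -- On a long enough block past `m`, the word `y s (a n)` forces membership in all these open
      -- sets, so it is not bad.
      obtain ⟨n, hmn, hn⟩ := hab s m
      have hz : (⟨n, fun i => ⟨y s (a n) i, (hyb s (a n) i).trans_le hn⟩⟩ : Q) ∈ D (s, m) :=
        hD ▸ trivial
      obtain hz | ⟨x, h1, h2, M, hM, k, hk, h3⟩ := hz
      · exact absurd hz (not_lt.2 hmn)
      · exact h3 (hb s (a n) _ ⟨M, hM, k, hk.trans ha.le_apply, rfl⟩ x h1 fun i hi hib =>
          h2 ⟨i, hib.trans_le hn⟩ hi))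
    (by
      intro A hA
      have hblk : ∀ i, ∃ n, a n ≤ i ∧ i < a (n + 1) := by
        intro i
        have hex : ∃ n, i < a (n + 1) := ⟨i, i.lt_succ_self.trans_le ha.le_apply⟩
        refine ⟨Nat.find hex, ?_, Nat.find_spec hex⟩
        rcases h : Nat.find hex with _ | l
        · omega
        · have := Nat.find_min hex (m := l) (by omega)
          omega
      choose blk hblk1 hblk2 using hblk
      have hblk3 : ∀ n i, a n ≤ i → i < a (n + 1) → blk i = n := by
        intro n i h1 h2
        have h3 := ha.lt_iff_lt.1 (h1.trans_lt (hblk2 i))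
        have h4 := ha.lt_iff_lt.1 ((hblk1 i).trans_lt h2)
        omega
      -- Glue the words chosen by `A`, with `0` on blocks where `A` chooses none. If the real `x`
      -- escapes `U M k`, it witnesses that every word of `A` from block `k` on is bad.
      let x : ℕ → ℕ := fun i =>
        if h : ∃ w, (⟨blk i, w⟩ : Q) ∈ A then (h.choose ⟨i, hblk2 i⟩ : ℕ) else 0
      have hx : ∀ i, x i < a (blk i + 1) := by
        intro i
        by_cases h : ∃ w, (⟨blk i, w⟩ : Q) ∈ A
        · simp only [x, dif_pos h]
          exact (h.choose _).2
        · simp only [x, dif_neg h]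
          have := hblk2 i
          omega
      have hxA : ∀ z ∈ A, ∀ i : Fin (a (z.1 + 1)), a z.1 ≤ i → x i = z.2 i := by
        rintro ⟨n, w⟩ hz ⟨i, hi⟩ hni
        obtain rfl := hblk3 n i hni hi
        have h : ∃ w, (⟨blk i, w⟩ : Q) ∈ A := ⟨w, hz⟩
        have hw : h.choose = w := eq_of_heq (Sigma.mk.inj (hA h.choose_spec hz rfl)).2
        simp only [x, dif_pos h]
        rw [hw]
      obtain ⟨M, hM, hxM⟩ := Set.mem_sUnion.1 (hcov ▸ Set.mem_univ x)
      obtain ⟨k, hk⟩ := hUM ⟨M, hM⟩ x hxM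
      refine ⟨({⟨M, hM⟩}, k), fun z hz => ?_⟩
      by_cases hzk : z.1 < k
      · exact Or.inl hzk
      · refine Or.inr ⟨x, fun i hi => (hx i).trans_le (ha.monotone ?_), hxA z hz, _,
          Finset.mem_singleton_self _, k, not_lt.1 hzk, hk⟩
        exact ha.lt_iff_lt.1 ((hblk1 i).trans_lt hi))
  refine (csInf_le' ⟨I, hIp, hIQ, rfl⟩ : nonClass IsQPlus ≤ _).trans (hIcof.trans ?_)
  -- As `F` is infinite, the index set `Finset F × ℕ` has the size of `F`.
  rw [Cardinal.mk_prod, Cardinal.lift_id, Cardinal.lift_id, hFin, Cardinal.mk_nat, hcard,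
    Cardinal.mul_aleph0_eq hinf]

end IdealInv

open IdealInv in
theorem mainTheorem12 :
    IdealInv.covMeager = min IdealInv.dominatingNumber (IdealInv.nonStar IdealInv.EDfin) ∧
      IdealInv.covMeager = min IdealInv.dominatingNumber (IdealInv.nonClass IdealInv.IsQPlus) := by
  have h1 := covMeager_le_dominatingNumber
  have h2 := covMeager_le_nonStar
  have h3 := nonStar_le_nonClass
  have h4 : min dominatingNumber (nonClass IsQPlus) ≤ covMeager := by
    obtain h | h := h1.lt_or_eq
    · exact (min_le_right _ _).trans (nonClass_isQPlus_le_covMeager h)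
    · exact (min_le_left _ _).trans h.ge
  exact ⟨(le_min h1 h2).antisymm ((min_le_min_left _ h3).trans h4),
    (le_min h1 (h2.trans h3)).antisymm h4⟩
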